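/- **Definitions.** A *Dyck word* of even length $N$ is a word $\sigma\in\{+1,-1\}^N$ with $\sum_{i\le N}\sigma(i)=0$ and $\sum_{i\le k}\sigma(i)\ge 0$ for all $k\le N$. A *re-pairing* of $\sigma$ is a sequence $p=((\ell_1,r_1),\dots,(\ell_{N/2},r_{N/2}))$ such that $\sigma(\ell_i)=+1$, $\sigma(r_i)=-1$, $\ell_i<r_i$ for all $i$, and every number in $\{1,\dots,N\}$ occurs in exactly one pair. Put $B_t(p)=\{\ell_i,r_i : i\le t\}$. The width of a finite set of integers is the smallest number of intervals $[a,b]=\{x\in\mathbb Z: a\le x\le b\}$ whose union is that set; $\operatorname{width}(p)=\max_t \operatorname{width}(B_t(p))$; and $\operatorname{width}(\sigma)$ is the minimum of $\operatorname{width}(p)$ over all re-pairings $p$ of $\sigma$. For even $n\ge 2$, the *universal one-counter set* $U_n$, over the alphabet $\{c_{ij}:0\le i<j<n\}\cup\{a_i:0\le i<n\}$, is the set of vectors $(y_{ij},x_i)$ of nonnegative integers (indexed by the letters $c_{ij}$ and $a_i$) such that 1. $y_{ij}\in\{0,1\}$ and the directed graph on $\{0,\dots,n-1\}$ with edge set $\{(i,j):y_{ij}=1\}$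 is a monotone path from $0$ to $n-1$; 2. $\sum_{i=0}^{n-1}(-1)^i x_i=0$ and $\sum_{i=0}^{k}(-1)^i x_i\ge 0$ for $0\le k<n-1$; 3. if $x_j>0$ and $j>0$, then $y_{ij}=1$ for some $i$; if $x_j>0$ and $j<n-1$, then $y_{jk}=1$ for some $k$. The *Parikh image* of a language is the set of vectors of letter counts of its words. **Theorem.** For every constant $C>0$ there is a constant $c>0$ such that the following holds for every even $n\ge 2$. Let $\sigma$ be any Dyck word of length at most $C\sqrt n$, and let $\mathcal A$ be a nondeterministic finite automaton recognizing a language whose Parikh image is $U_n$. Then $\mathcal A$ has at least $n^{c\cdot\operatorname{width}(\sigma)}$ states. (That is, if $\sigma_n$ has length $O(\sqrt n)$, then the number of states is $n^{\Omega(\operatorname{width}(\sigma_n))}$.) -/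

import Mathlib

/-- The width of a set of positions: the smallest number of intervals `[a, b]` whose union is the
set. It is used for finite sets only (where such a number exists). -/
noncomputable def setWidth (S : Set ℕ) : ℕ :=
  sInf {k : ℕ | ∃ a b : Fin k → ℕ, S = ⋃ i, Set.Icc (a i) (b i)}

/-- A re-pairing of a Dyck word `σ` of length `N`: a sequence of `N / 2` pairs
`(left i, right i)` of positions of `σ` (numbered from `0`), each formed by an opening bracket and
a closing bracket to the right of it, such that every position occurs in exactly one pair. -/
structure RePairing (σ : DyckWord) where
  left : Fin σ.semilength → Fin σ.toList.length
  right : Fin σ.semilength → Fin σ.toList.length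
  get_left : ∀ i, σ.toList.get (left i) = DyckStep.U
  get_right : ∀ i, σ.toList.get (right i) = DyckStep.D
  left_lt_right : ∀ i, left i < right i
  existsUnique_pair : ∀ b : Fin σ.toList.length, ∃! i, left i = b ∨ right i = b

/-- The set of positions erased by the first `t` pairs of a re-pairing. -/
def RePairing.erased {σ : DyckWord} (p : RePairing σ) (t : ℕ) : Set ℕ :=
  {b : ℕ | ∃ i : Fin σ.semilength, (i : ℕ) < t ∧ (b = (p.left i : ℕ) ∨ b = (p.right i : ℕ))}

/-- The width of a re-pairing: the maximum over all times `t ≤ N / 2` of the width of the set of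
positions erased up to time `t`. -/
noncomputable def RePairing.width {σ : DyckWord} (p : RePairing σ) : ℕ :=
  (Finset.range (σ.semilength + 1)).sup fun t => setWidth (p.erased t)

/-- The width of a Dyck word: the minimum of the widths of its re-pairings. -/
noncomputable def DyckWord.width (σ : DyckWord) : ℕ :=
  sInf (Set.range fun p : RePairing σ => p.width)

/-- The alphabet `{c_{ij} : 0 ≤ i < j < n} ∪ {a_i : 0 ≤ i < n}`. -/
inductive OCLetter (n : ℕ) where
  | c (i j : Fin n) (h : i < j) : OCLetter n
  | a (i : Fin n) : OCLetter n
  deriving DecidableEq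

/-- The Parikh image of a language: the set of the vectors of letter counts of its words. -/
def parikhImage {α : Type*} [DecidableEq α] (L : Language α) : Set (α → ℕ) :=
  {v | ∃ w ∈ L, v = fun a => w.count a}

/-- `y` takes values in `{0, 1}`, and the directed graph with edges `{(i, j) : y_{ij} = 1}` is a
monotone path from `0` to `n - 1`; `l` lists the vertices of the path, and its edges are the pairs
of consecutive entries of `l`. -/
def IsChainVector (n : ℕ) (y : (i j : Fin n) → i < j → ℕ) : Prop :=
  (∀ i j h, y i j h = 0 ∨ y i j h = 1) ∧
  ∃ l : List (Fin n), l.IsChain (· < ·) ∧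
    (∃ s ∈ l.head?, (s : ℕ) = 0) ∧ (∃ t ∈ l.getLast?, (t : ℕ) + 1 = n) ∧
    ∀ i j h, y i j h = 1 ↔ (i, j) ∈ l.zip l.tail

/-- `x` is a balanced vector. -/
def IsBalancedVector (n : ℕ) (x : Fin n → ℕ) : Prop :=
  ∑ i : Fin n, (-1 : ℤ) ^ (i : ℕ) * (x i : ℤ) = 0 ∧
  ∀ k : Fin n, (k : ℕ) + 1 < n → 0 ≤ ∑ i ∈ Finset.Iic k, (-1 : ℤ) ^ (i : ℕ) * (x i : ℤ)

/-- `x` is compatible with `y`: every `j` with `x_j > 0` has an incoming edge unless `j = 0`, and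
an outgoing edge unless `j = n - 1`. -/
def IsCompatible (n : ℕ) (y : (i j : Fin n) → i < j → ℕ) (x : Fin n → ℕ) : Prop :=
  ∀ j : Fin n, 0 < x j →
    (0 < (j : ℕ) → ∃ (i : Fin n) (h : i < j), y i j h = 1) ∧
    ((j : ℕ) + 1 < n → ∃ (k : Fin n) (h : j < k), y j k h = 1)

/-- The universal one-counter set `U_n`; the coordinate `y_{ij}` of a vector is its value at the
letter `c_{ij}`, and the coordinate `x_i` is its value at `a_i`. -/
def universalOneCounterSet (n : ℕ) : Set (OCLetter n → ℕ) :=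
  {v | IsChainVector n (fun i j h => v (OCLetter.c i j h)) ∧
    IsBalancedVector n (fun i => v (OCLetter.a i)) ∧
    IsCompatible n (fun i j h => v (OCLetter.c i j h)) (fun i => v (OCLetter.a i))}

/-!
Place the letters of `σ` at inner vertices of a path, opening brackets at even and closing brackets
at odd vertices, and consider an accepted word whose path visits exactly these vertices and in which
each of their letters occurs at least as often as the automaton has states. Every cycle of a run on
the word can be pumped, so it reads no edge letter and, from each vertex on, no more even than odd
vertex letters. As the letters between two cycles are few, Hall's theorem matches every opening
bracket with a later closing bracket whose letter occurs on a common cycle at some time of the run,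
and ordering the pairs by these times gives a re-pairing of `σ`.

Call a vertex forced by a state if every word accepted through the state visits it. At each time of
the run, a bracket at a vertex not forced by the current state has been erased if and only if the
edges at its vertex have been read, and consecutive brackets share an edge. Intervals of erased
positions therefore begin and end next to forced vertices, so some state of the run forces at least
`width σ / 2` of the chosen vertices.

Let each of the `N` letters vary independently over `b` possible vertices. A state that forces `s`
vertices can serve at most `b ^ (N - s)` of the `b ^ N` placements, so there are at least `b ^ s`
states, and a short `σ` leaves room for `b` to be a power of `n`. When `n` or the width is too small
for this to say anything, it suffices that the automaton has at least `n` states.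
-/

theorem exists_first_eq {N : ℕ} {f : ℕ → ℤ} (hstep : ∀ i < N, f (i + 1) ≤ f i + 1) {v : ℤ}
    (h0 : f 0 ≤ v) (hN : v ≤ f N) : ∃ i ≤ N, f i = v ∧ ∀ j < i, f j < v := by
  have hex : ∃ i, v ≤ f i := ⟨N, hN⟩
  have hle : Nat.find hex ≤ N := Nat.find_min' hex hN
  have hbefore : ∀ j < Nat.find hex, f j < v := fun j hj => not_le.mp (Nat.find_min hex hj)
  refine ⟨Nat.find hex, hle, le_antisymm ?_ (Nat.find_spec hex), hbefore⟩
  rcases hk : Nat.find hex with _ | k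
  · exact h0
  · have := hstep k (by omega)
    have := hbefore k (by omega)
    omega

theorem lt_add_card_of_le_at_repetitions {Q : Type*} [Fintype Q] {N : ℕ} {st : ℕ → Q}
    {f : ℕ → ℤ} (hstep : ∀ i < N, f (i + 1) ≤ f i + 1)
    (hrep : ∀ i j, i < j → j ≤ N → st i = st j → f j ≤ f i) :
    f N < f 0 + Fintype.card Q := by
  by_contra! hN
  choose t htN hft hbefore using fun v : Fin (Fintype.card Q + 1) =>
    exists_first_eq hstep (v := f 0 + (v : ℕ)) (by omega) (by have := v.is_le; omega)
  have hne : ∀ u v, u < v → st (t u) ≠ st (t v) := by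
    intro u v huv hst
    rw [Fin.lt_def] at huv
    have htuv : t u < t v := by
      by_contra! hle
      rcases hle.lt_or_eq with hlt | heq
      · have := hbefore u _ hlt
        have := hft v
        omega
      · have := hft u
        have := heq ▸ hft v
        omega
    have := hrep _ _ htuv (htN v) hst
    have := hft u
    have := hft v
    omega
  have hinj : Function.Injective fun v => st (t v) := by
    intro u v huv
    by_contra hneq
    rcases lt_or_gt_of_ne hneq with h | h
    · exact hne u v h huv
    · exact hne v u h huv.symm
  simpa using Fintype.card_le_of_injective _ hinj

section Runs

variable {α Q : Type*} {A : NFA α Q} {w : List α} {st : ℕ → Q}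

/-- `st` is the sequence of states of an accepting run of `A` on `w`: the automaton is in state
`st i` after reading the first `i` letters. The values of `st` beyond `w.length` are arbitrary. -/
structure IsAcceptingRun (A : NFA α Q) (w : List α) (st : ℕ → Q) : Prop where
  start : st 0 ∈ A.start
  accept : st w.length ∈ A.accept
  step : ∀ i (h : i < w.length), st (i + 1) ∈ A.step (st i) w[i]

theorem exists_states_of_mem_evalFrom {p q : Q} (h : q ∈ A.evalFrom {p} w) :
    ∃ st : ℕ → Q, st 0 = p ∧ st w.length = q ∧
      ∀ i (h : i < w.length), st (i + 1) ∈ A.step (st i) w[i] := by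
  induction w generalizing p with
  | nil => exact ⟨fun _ => p, rfl, by simpa using h.symm, by simp⟩
  | cons a w ih =>
    rw [NFA.evalFrom_cons, NFA.stepSet_singleton, NFA.mem_evalFrom_iff_exists] at h
    obtain ⟨r, hr, hq⟩ := h
    obtain ⟨st, hst0, hstq, hst⟩ := ih hq
    refine ⟨fun i => i.casesOn p st, rfl, hstq, ?_⟩
    rintro (_ | i) hi
    · simpa [hst0] using hr
    · simpa using hst i (by simpa using hi)

theorem exists_isAcceptingRun (hw : w ∈ A.accepts) : ∃ st, IsAcceptingRun A w st := by
  obtain ⟨q, hq, hw⟩ := NFA.mem_accepts.mp hw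
  obtain ⟨p, hp, hw⟩ := NFA.mem_evalFrom_iff_exists.mp hw
  obtain ⟨st, rfl, rfl, hstep⟩ := exists_states_of_mem_evalFrom hw
  exact ⟨st, hp, hq, hstep⟩

namespace IsAcceptingRun

theorem mem_evalFrom (hst : IsAcceptingRun A w st) {i j : ℕ} (hij : i ≤ j)
    (hj : j ≤ w.length) : st j ∈ A.evalFrom {st i} ((w.take j).drop i) := by
  induction j, hij using Nat.le_induction with
  | base => simp
  | succ j hij ih =>
    rw [List.take_add_one, List.drop_append_of_le_length (by simp; omega), NFA.evalFrom_append,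
      List.getElem?_eq_getElem (by omega), Option.toList_some, NFA.evalFrom_singleton,
      NFA.mem_stepSet]
    exact ⟨st j, ih (by omega), hst.step j (by omega)⟩

theorem mem_eval_take (hst : IsAcceptingRun A w st) {i : ℕ} (hi : i ≤ w.length) :
    st i ∈ A.eval (w.take i) :=
  NFA.mem_evalFrom_iff_exists.mpr
    ⟨st 0, hst.start, by simpa using hst.mem_evalFrom (Nat.zero_le i) hi⟩

theorem drop_mem_acceptsFrom (hst : IsAcceptingRun A w st) {i : ℕ} (hi : i ≤ w.length) :
    w.drop i ∈ A.acceptsFrom {st i} :=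
  ⟨st w.length, hst.accept, by simpa using hst.mem_evalFrom hi le_rfl⟩

end IsAcceptingRun

theorem take_append_drop_take {i j : ℕ} (hij : i ≤ j) :
    w.take i ++ (w.take j).drop i = w.take j := by
  conv_rhs => rw [← List.take_append_drop i (w.take j), List.take_take, min_eq_left hij]

theorem append_mem_accepts {u v : List α} {q : Q} (hu : q ∈ A.eval u)
    (hv : v ∈ A.acceptsFrom {q}) : u ++ v ∈ A.accepts := by
  obtain ⟨r, hr, hv⟩ := hv
  refine NFA.mem_accepts.mpr ⟨r, hr, ?_⟩
  rw [NFA.evalFrom_append, NFA.mem_evalFrom_iff_exists]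
  exact ⟨q, hu, hv⟩

theorem mem_eval_append {u y : List α} {q r : Q} (hu : q ∈ A.eval u)
    (hy : r ∈ A.evalFrom {q} y) : r ∈ A.eval (u ++ y) := by
  rw [NFA.eval, NFA.evalFrom_append, NFA.mem_evalFrom_iff_exists]
  exact ⟨q, hu, hy⟩

theorem append_mem_acceptsFrom {y v : List α} {q r : Q} (hy : r ∈ A.evalFrom {q} y)
    (hv : v ∈ A.acceptsFrom {r}) : y ++ v ∈ A.acceptsFrom {q} := by
  obtain ⟨s, hs, hv⟩ := hv
  refine ⟨s, hs, ?_⟩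
  rw [NFA.evalFrom_append, NFA.mem_evalFrom_iff_exists]
  exact ⟨r, hy, hv⟩

theorem mem_evalFrom_flatten_replicate {q : Q} {y : List α} (hy : q ∈ A.evalFrom {q} y) (m : ℕ) :
    q ∈ A.evalFrom {q} (List.replicate m y).flatten := by
  induction m with
  | zero => simp
  | succ m ih =>
    rw [List.replicate_succ, List.flatten_cons, NFA.evalFrom_append, NFA.mem_evalFrom_iff_exists]
    exact ⟨q, hy, ih⟩

end Runs

section Width

variable {S : Set ℕ} {E : Finset ℕ}

theorem exists_Icc_subset_of_mem (h0 : 0 ∈ S → 0 ∈ E)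
    (hsucc : ∀ x, x ∉ S → x + 1 ∈ S → x + 1 ∈ E) {x : ℕ} (hx : x ∈ S) :
    ∃ s ∈ E, s ∈ S ∧ s ≤ x ∧ Set.Icc s x ⊆ S := by
  induction x with
  | zero => exact ⟨0, h0 hx, hx, le_rfl, by simpa using hx⟩
  | succ x ih =>
    by_cases hxS : x ∈ S
    · obtain ⟨s, hsE, hs, hsx, hIcc⟩ := ih hxS
      refine ⟨s, hsE, hs, by omega, fun y ⟨hsy, hyx⟩ => ?_⟩
      rcases hyx.lt_or_eq with hlt | rfl
      · exact hIcc ⟨hsy, by omega⟩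
      · exact hx
    · exact ⟨x + 1, hsucc x hxS hx, hx, le_rfl, by simpa using hx⟩

theorem setWidth_le_card (hS : BddAbove S) (h0 : 0 ∈ S → 0 ∈ E)
    (hsucc : ∀ x, x ∉ S → x + 1 ∈ S → x + 1 ∈ E) : setWidth S ≤ E.card := by
  classical
  let right (s : ℕ) : ℕ := sSup {y | Set.Icc s y ⊆ S}
  have right_bdd : ∀ s ∈ S, BddAbove {y | Set.Icc s y ⊆ S} := by
    obtain ⟨b, hb⟩ := hS
    intro s hs
    refine ⟨b, fun y hy => ?_⟩
    rcases le_or_gt s y with hsy | hys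
    · exact hb (hy ⟨hsy, le_rfl⟩)
    · exact hys.le.trans (hb hs)
  have Icc_right_subset : ∀ s ∈ S, Set.Icc s (right s) ⊆ S := fun s hs =>
    Nat.sSup_mem ⟨s, by simpa using hs⟩ (right_bdd s hs)
  let F := E.filter (· ∈ S)
  refine (Nat.sInf_le ?_ : setWidth S ≤ F.card).trans (Finset.card_filter_le _ _)
  refine ⟨fun i => F.equivFin.symm i, fun i => right (F.equivFin.symm i), ?_⟩
  ext x
  simp only [Set.mem_iUnion]
  constructor
  · intro hx
    obtain ⟨s, hsE, hs, hsx, hIcc⟩ := exists_Icc_subset_of_mem h0 hsucc hx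
    refine ⟨F.equivFin ⟨s, Finset.mem_filter.mpr ⟨hsE, hs⟩⟩, ?_⟩
    simpa [hsx] using le_csSup (right_bdd s hs) hIcc
  · rintro ⟨i, hi⟩
    exact Icc_right_subset _ (Finset.mem_filter.mp (F.equivFin.symm i).2).2 hi

theorem setWidth_le_two_mul_card_add_one (hS : BddAbove S) {K : Finset ℕ}
    (hK : ∀ x, x ∉ K → x + 1 ∉ K → x + 1 ∈ S → x ∈ S) : setWidth S ≤ 2 * K.card + 1 := by
  refine (setWidth_le_card (E := insert 0 (K ∪ K.image (· + 1))) hS (by simp) ?_).trans ?_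
  · intro x hx hx1
    by_contra hE
    simp only [Finset.mem_insert, Finset.mem_union, Finset.mem_image, Nat.add_right_cancel_iff,
      exists_eq_right, not_or] at hE
    exact hx (hK x hE.2.2 hE.2.1 hx1)
  · have h1 := Finset.card_insert_le 0 (K ∪ K.image (· + 1))
    have h2 := Finset.card_union_le K (K.image (· + 1))
    have h3 := Finset.card_image_le (s := K) (f := (· + 1))
    omega

namespace RePairing

variable {σ : DyckWord}

theorem bddAbove_erased (p : RePairing σ) (t : ℕ) : BddAbove (p.erased t) := by
  refine ⟨σ.toList.length, ?_⟩
  rintro b ⟨i, -, rfl | rfl⟩ <;> exact Fin.is_le'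

theorem mem_erased_iff (p : RePairing σ) {i : Fin σ.semilength} {k : Fin σ.toList.length}
    (hk : p.left i = k ∨ p.right i = k) {t : ℕ} : (k : ℕ) ∈ p.erased t ↔ (i : ℕ) < t := by
  constructor
  · rintro ⟨j, hjt, hj⟩
    have hjk : p.left j = k ∨ p.right j = k :=
      hj.imp (fun h => Fin.ext h.symm) (fun h => Fin.ext h.symm)
    rwa [(p.existsUnique_pair k).unique hk hjk]
  · intro hit
    exact ⟨i, hit, hk.imp (fun h => by rw [h]) (fun h => by rw [h])⟩

theorem exists_width_le_setWidth_erased (p : RePairing σ) :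
    ∃ t ≤ σ.semilength, σ.width ≤ setWidth (p.erased t) := by
  obtain ⟨t, hts, ht⟩ := Finset.exists_mem_eq_sup (Finset.range (σ.semilength + 1))
    Finset.nonempty_range_add_one fun t => setWidth (p.erased t)
  exact ⟨t, Finset.mem_range_succ_iff.mp hts,
    (Nat.sInf_le ⟨p, rfl⟩ : σ.width ≤ p.width).trans_eq ht⟩

end RePairing

theorem width_le_length (σ : DyckWord) : σ.width ≤ σ.toList.length := by
  rcases isEmpty_or_nonempty (RePairing σ) with hempty | ⟨⟨p⟩⟩
  · simp [DyckWord.width, Set.range_eq_empty]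
  · obtain ⟨t, -, ht⟩ := p.exists_width_le_setWidth_erased
    have mem_range : ∀ b ∈ p.erased t, b ∈ Finset.range σ.toList.length := by
      rintro b ⟨i, -, rfl | rfl⟩ <;> simp
    have := setWidth_le_card (p.bddAbove_erased t) (mem_range 0) fun x _ => mem_range (x + 1)
    rw [Finset.card_range] at this
    exact ht.trans this

end Width

section ConsecutivePairs

variable {α : Type*} {l : List α} {x x' y y' : α}

theorem mem_zip_tail_iff :
    (x, y) ∈ l.zip l.tail ↔ ∃ (m : ℕ) (h : m + 1 < l.length), l[m] = x ∧ l[m + 1] = y := by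
  simp only [List.mem_iff_getElem, List.getElem_zip, List.getElem_tail, Prod.mk.injEq,
    List.length_zip, List.length_tail]
  exact exists_congr fun m => ⟨fun ⟨h, e⟩ => ⟨by omega, e⟩, fun ⟨h, e⟩ => ⟨by omega, e⟩⟩

theorem exists_pred_mem_zip_tail (hy : y ∈ l) (hhead : y ∉ l.head?) :
    ∃ x, (x, y) ∈ l.zip l.tail := by
  obtain ⟨m, hm, rfl⟩ := List.getElem_of_mem hy
  rcases m with _ | m
  · exact absurd (by simp [List.head?_eq_getElem?, hm]) hhead
  · exact ⟨l[m], mem_zip_tail_iff.mpr ⟨m, hm, rfl, rfl⟩⟩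

theorem exists_succ_mem_zip_tail (hx : x ∈ l) (hlast : x ∉ l.getLast?) :
    ∃ y, (x, y) ∈ l.zip l.tail := by
  obtain ⟨m, hm, rfl⟩ := List.getElem_of_mem hx
  have hne : m ≠ l.length - 1 := by
    rintro rfl
    exact hlast (by simp [List.getLast?_eq_getElem?, hm])
  exact ⟨l[m + 1], mem_zip_tail_iff.mpr ⟨m, by omega, rfl, rfl⟩⟩

variable [Preorder α]

theorem lt_of_mem_zip_tail (hl : l.IsChain (· < ·)) (h : (x, y) ∈ l.zip l.tail) : x < y := by
  obtain ⟨m, hm, rfl, rfl⟩ := mem_zip_tail_iff.mp h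
  exact List.isChain_iff_getElem.mp hl m hm

theorem pred_unique_of_mem_zip_tail (hl : l.IsChain (· < ·)) (h : (x, y) ∈ l.zip l.tail)
    (h' : (x', y) ∈ l.zip l.tail) : x = x' := by
  obtain ⟨m, hm, rfl, rfl⟩ := mem_zip_tail_iff.mp h
  obtain ⟨m', hm', rfl, he⟩ := mem_zip_tail_iff.mp h'
  have hnodup : l.Nodup := hl.pairwise.imp fun h => h.ne
  obtain rfl : m' = m := by simpa using hnodup.getElem_inj_iff.mp he
  rfl

theorem succ_unique_of_mem_zip_tail (hl : l.IsChain (· < ·)) (h : (x, y) ∈ l.zip l.tail)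
    (h' : (x, y') ∈ l.zip l.tail) : y = y' := by
  obtain ⟨m, hm, rfl, rfl⟩ := mem_zip_tail_iff.mp h
  obtain ⟨m', hm', he, rfl⟩ := mem_zip_tail_iff.mp h'
  have hnodup : l.Nodup := hl.pairwise.imp fun h => h.ne
  obtain rfl : m' = m := hnodup.getElem_inj_iff.mp he
  rfl

end ConsecutivePairs

section AlternatingSums

variable {n : ℕ}

theorem sum_alternating_eq_sum_even_sub_sum_odd (T : Finset (Fin n)) (x : Fin n → ℕ) :
    ∑ i ∈ T, (-1 : ℤ) ^ (i : ℕ) * (x i : ℤ) =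
      (∑ i ∈ T.filter (Even ·.val), x i : ℕ) - (∑ i ∈ T.filter (Odd ·.val), x i : ℕ) := by
  simp only [Nat.cast_sum, Finset.sum_filter, ← Finset.sum_sub_distrib]
  refine Finset.sum_congr rfl fun i _ => ?_
  rcases Nat.even_or_odd (i : ℕ) with hi | hi
  · simp [hi, Nat.not_odd_iff_even.mpr hi]
  · simp [hi, Nat.not_even_iff_odd.mpr hi]

theorem IsBalancedVector.sum_even_Ici_le_sum_odd_Ici {x : Fin n → ℕ} (hx : IsBalancedVector n x)
    (k : Fin n) :
    ∑ i ∈ (Finset.Ici k).filter (Even ·.val), x i ≤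
      ∑ i ∈ (Finset.Ici k).filter (Odd ·.val), x i := by
  suffices h : ∑ i ∈ Finset.Ici k, (-1 : ℤ) ^ (i : ℕ) * (x i : ℤ) ≤ 0 by
    rw [sum_alternating_eq_sum_even_sub_sum_odd] at h
    omega
  by_cases hk : (k : ℕ) = 0
  · have : Finset.Ici k = Finset.univ := by ext i; simp [Fin.le_def, hk]
    exact (this ▸ hx.1).le
  · have hprefix := hx.2 ⟨k - 1, by omega⟩ (by dsimp only; omega)
    have hcompl : (Finset.Iic (⟨k - 1, by omega⟩ : Fin n))ᶜ = Finset.Ici k := by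
      ext i
      simp only [Finset.mem_compl, Finset.mem_Iic, Finset.mem_Ici, Fin.le_def]
      omega
    have hsum := hx.1
    rw [← Finset.sum_add_sum_compl (Finset.Iic (⟨k - 1, by omega⟩ : Fin n)), hcompl] at hsum
    linarith

end AlternatingSums

section Words

variable {n : ℕ} {u v w y : List (OCLetter n)} {k : Fin n}

/-- A word whose vector of letter counts lies in the universal one-counter set. -/
def IsUniversalWord (w : List (OCLetter n)) : Prop :=
  (fun a => w.count a) ∈ universalOneCounterSet n

/-- The word contains the letter of an edge entering the vertex `k`. -/
def HasIncoming (w : List (OCLetter n)) (k : Fin n) : Prop :=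
  ∃ i h, OCLetter.c i k h ∈ w

/-- The word contains the letter of an edge leaving the vertex `k`. -/
def HasOutgoing (w : List (OCLetter n)) (k : Fin n) : Prop :=
  ∃ j h, OCLetter.c k j h ∈ w

/-- A vertex of the path other than its two ends `0` and `n - 1`. -/
def IsInnerVertex (k : Fin n) : Prop :=
  0 < (k : ℕ) ∧ (k : ℕ) + 1 < n

theorem hasIncoming_append : HasIncoming (u ++ v) k ↔ HasIncoming u k ∨ HasIncoming v k := by
  simp only [HasIncoming, List.mem_append, exists_or]

theorem hasOutgoing_append : HasOutgoing (u ++ v) k ↔ HasOutgoing u k ∨ HasOutgoing v k := by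
  simp only [HasOutgoing, List.mem_append, exists_or]

namespace IsUniversalWord

theorem count_edge_le_one (hw : IsUniversalWord w) (i j : Fin n) (h : i < j) :
    w.count (OCLetter.c i j h) ≤ 1 := by
  have : w.count (OCLetter.c i j h) = 0 ∨ w.count (OCLetter.c i j h) = 1 := hw.1.1 i j h
  omega

theorem count_edge_eq_one_iff (hw : IsUniversalWord w) {i j : Fin n} {h : i < j} :
    w.count (OCLetter.c i j h) = 1 ↔ OCLetter.c i j h ∈ w := by
  have := hw.count_edge_le_one i j h
  rw [← List.count_pos_iff]
  omega

theorem exists_path (hw : IsUniversalWord w) :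
    ∃ l : List (Fin n), l.IsChain (· < ·) ∧ (∀ s ∈ l.head?, (s : ℕ) = 0) ∧
      (∀ t ∈ l.getLast?, (t : ℕ) + 1 = n) ∧
      ∀ i j h, OCLetter.c i j h ∈ w ↔ (i, j) ∈ l.zip l.tail := by
  obtain ⟨l, hl, ⟨s, hs, hs0⟩, ⟨t, ht, htn⟩, hedge⟩ := hw.1.2
  exact ⟨l, hl, fun s' hs' => Option.mem_unique hs hs' ▸ hs0,
    fun t' ht' => Option.mem_unique ht ht' ▸ htn,
    fun i j h => hw.count_edge_eq_one_iff.symm.trans (hedge i j h)⟩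

theorem hasIncoming_iff_hasOutgoing (hw : IsUniversalWord w) (hk : IsInnerVertex k) :
    HasIncoming w k ↔ HasOutgoing w k := by
  obtain ⟨l, hl, hhead, hlast, hedge⟩ := hw.exists_path
  constructor
  · rintro ⟨i, h, hi⟩
    have hkl : k ∈ l := List.mem_of_mem_tail (List.of_mem_zip ((hedge i k h).mp hi)).2
    obtain ⟨j, hj⟩ := exists_succ_mem_zip_tail hkl fun ht => hk.2.ne (hlast k ht)
    have hkj := lt_of_mem_zip_tail hl hj
    exact ⟨j, hkj, (hedge k j hkj).mpr hj⟩
  · rintro ⟨j, h, hj⟩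
    have hkl : k ∈ l := (List.of_mem_zip ((hedge k j h).mp hj)).1
    obtain ⟨i, hi⟩ := exists_pred_mem_zip_tail hkl fun hs => hk.1.ne' (hhead k hs)
    have hik := lt_of_mem_zip_tail hl hi
    exact ⟨i, hik, (hedge i k hik).mpr hi⟩

theorem edge_notMem_right (hw : IsUniversalWord (u ++ v)) {i j : Fin n} {h : i < j}
    (hu : OCLetter.c i j h ∈ u) : OCLetter.c i j h ∉ v := by
  intro hv
  have hcount := hw.count_edge_le_one i j h
  rw [List.count_append] at hcount
  have := List.count_pos_iff.mpr hu
  have := List.count_pos_iff.mpr hv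
  omega

theorem not_hasIncoming_right (hw : IsUniversalWord (u ++ v)) (hu : HasIncoming u k) :
    ¬ HasIncoming v k := by
  rintro ⟨i', h', hi'⟩
  obtain ⟨i, h, hi⟩ := hu
  obtain ⟨l, hl, -, -, hedge⟩ := hw.exists_path
  obtain rfl : i = i' := pred_unique_of_mem_zip_tail hl
    ((hedge i k h).mp (List.mem_append_left v hi))
    ((hedge i' k h').mp (List.mem_append_right u hi'))
  exact hw.edge_notMem_right hi hi'

theorem not_hasOutgoing_right (hw : IsUniversalWord (u ++ v)) (hu : HasOutgoing u k) :
    ¬ HasOutgoing v k := by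
  rintro ⟨j', h', hj'⟩
  obtain ⟨j, h, hj⟩ := hu
  obtain ⟨l, hl, -, -, hedge⟩ := hw.exists_path
  obtain rfl : j = j' := succ_unique_of_mem_zip_tail hl
    ((hedge k j h).mp (List.mem_append_left v hj))
    ((hedge k j' h').mp (List.mem_append_right u hj'))
  exact hw.edge_notMem_right hj hj'

theorem hasIncoming_of_mem (hw : IsUniversalWord w) (hk : OCLetter.a k ∈ w)
    (hinner : IsInnerVertex k) : HasIncoming w k := by
  obtain ⟨i, h, hi⟩ := (hw.2.2 k (List.count_pos_iff.mpr hk)).1 hinner.1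
  exact ⟨i, h, hw.count_edge_eq_one_iff.mp hi⟩

end IsUniversalWord

/-- The number of letters `a_i` of the word with `i ∈ T`. -/
def vertexCount (T : Finset (Fin n)) (w : List (OCLetter n)) : ℕ :=
  ∑ i ∈ T, w.count (OCLetter.a i)

theorem vertexCount_append (T : Finset (Fin n)) :
    vertexCount T (u ++ v) = vertexCount T u + vertexCount T v := by
  simp only [vertexCount, List.count_append, Finset.sum_add_distrib]

theorem vertexCount_flatten_replicate (T : Finset (Fin n)) (m : ℕ) :
    vertexCount T (List.replicate m y).flatten = m * vertexCount T y := by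
  simp [vertexCount, List.count_flatten, Finset.mul_sum]

theorem vertexCount_singleton_le_one (T : Finset (Fin n)) (b : OCLetter n) :
    vertexCount T [b] ≤ 1 := by
  simp only [vertexCount, List.count_singleton, beq_iff_eq, Finset.sum_boole, Nat.cast_id]
  refine Finset.card_le_one.mpr fun i hi j hj => ?_
  rw [Finset.mem_filter] at hi hj
  exact OCLetter.a.inj (hi.2.symm.trans hj.2)

theorem IsUniversalWord.vertexCount_even_le_odd (hw : IsUniversalWord w) (k : Fin n) :
    vertexCount ((Finset.Ici k).filter (Even ·.val)) w ≤
      vertexCount ((Finset.Ici k).filter (Odd ·.val)) w :=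
  hw.2.1.sum_even_Ici_le_sum_odd_Ici k

end Words

section Pumping

variable {n : ℕ} {u v y : List (OCLetter n)}

/-- Every word obtained by repeating the middle factor `y` of `u ++ y ++ v` is universal. -/
def IsPumpable (u y v : List (OCLetter n)) : Prop :=
  ∀ m : ℕ, IsUniversalWord (u ++ ((List.replicate m y).flatten ++ v))

namespace IsPumpable

theorem edge_notMem (h : IsPumpable u y v) (i j : Fin n) (hij : i < j) :
    OCLetter.c i j hij ∉ y := by
  intro hy
  have hcount := (h 2).count_edge_le_one i j hij
  have := List.count_pos_iff.mpr hy
  simp only [List.replicate, List.flatten_cons, List.flatten_nil, List.count_append] at hcount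
  omega

theorem vertexCount_le_of_forall (h : IsPumpable u y v) {E O : Finset (Fin n)}
    (hEO : ∀ w, IsUniversalWord w → vertexCount E w ≤ vertexCount O w) :
    vertexCount E y ≤ vertexCount O y := by
  by_contra! hlt
  have hpump := hEO _ (h (vertexCount O u + vertexCount O v + 1))
  simp only [vertexCount_append, vertexCount_flatten_replicate] at hpump
  have := Nat.mul_le_mul_left (vertexCount O u + vertexCount O v + 1) (Nat.succ_le_of_lt hlt)
  rw [Nat.mul_succ] at this
  omega

theorem vertexCount_le_of_odd_subset (h : IsPumpable u y v) {E O : Finset (Fin n)}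
    (hE : ∀ i ∈ E, Even (i : ℕ))
    (hO : ∀ i ∈ E, OCLetter.a i ∈ y → ∀ j, i < j → Odd (j : ℕ) → OCLetter.a j ∈ y → j ∈ O) :
    vertexCount E y ≤ vertexCount O y := by
  rcases (E.filter (OCLetter.a · ∈ y)).eq_empty_or_nonempty with hempty | hne
  · have : vertexCount E y = 0 := Finset.sum_eq_zero fun i hi =>
      List.count_eq_zero.mpr (Finset.filter_eq_empty_iff.mp hempty hi)
    omega
  obtain ⟨hmin, hminy⟩ := Finset.mem_filter.mp (Finset.min'_mem _ hne)
  set i₀ := Finset.min' _ hne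
  calc vertexCount E y
      ≤ vertexCount {i ∈ Finset.Ici i₀ | Even (i : ℕ)} y := by
        refine Finset.sum_le_sum_of_ne_zero fun i hi hcount => ?_
        have hiy : OCLetter.a i ∈ y := List.count_pos_iff.mp (Nat.pos_of_ne_zero hcount)
        exact Finset.mem_filter.mpr ⟨Finset.mem_Ici.mpr
          (Finset.min'_le _ _ (Finset.mem_filter.mpr ⟨hi, hiy⟩)), hE i hi⟩
    _ ≤ vertexCount {i ∈ Finset.Ici i₀ | Odd (i : ℕ)} y :=
        h.vertexCount_le_of_forall fun _ hw => hw.vertexCount_even_le_odd i₀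
    _ ≤ vertexCount O y := by
        refine Finset.sum_le_sum_of_ne_zero fun j hj hcount => ?_
        obtain ⟨hle, hodd⟩ := Finset.mem_filter.mp hj
        have hlt : i₀ < j := (Finset.mem_Ici.mp hle).lt_of_ne fun h =>
          Nat.not_odd_iff_even.mpr (hE i₀ hmin) (h ▸ hodd)
        exact hO i₀ hmin hminy j hlt hodd (List.count_pos_iff.mp (Nat.pos_of_ne_zero hcount))

end IsPumpable

end Pumping

section Forced

variable {n : ℕ} {Q : Type*} {A : NFA (OCLetter n) Q} {q r : Q} {u v y : List (OCLetter n)}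
  {k : Fin n}

/-- The inner vertices that lie on the path of every word accepted by a run through the
state `q`. -/
def forcedVertices (A : NFA (OCLetter n) Q) (q : Q) : Set (Fin n) :=
  {k | IsInnerVertex k ∧ ∀ u v, q ∈ A.eval u → v ∈ A.acceptsFrom {q} → HasIncoming (u ++ v) k}

/-- The vertices whose letters occur on a cycle of the automaton through the state `q`. -/
def cycleVertices (A : NFA (OCLetter n) Q) (q : Q) : Set (Fin n) :=
  {k | ∃ y, q ∈ A.evalFrom {q} y ∧ OCLetter.a k ∈ y}

theorem isPumpable_of_mem_evalFrom (hA : ∀ w ∈ A.accepts, IsUniversalWord w) (hu : q ∈ A.eval u)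
    (hy : q ∈ A.evalFrom {q} y) (hv : v ∈ A.acceptsFrom {q}) : IsPumpable u y v := fun m =>
  hA _ (append_mem_accepts hu (append_mem_acceptsFrom (mem_evalFrom_flatten_replicate hy m) hv))

theorem not_hasIncoming_of_cycle (hA : ∀ w ∈ A.accepts, IsUniversalWord w) (hu : q ∈ A.eval u)
    (hy : q ∈ A.evalFrom {q} y) (hv : v ∈ A.acceptsFrom {q}) : ¬ HasIncoming y k := by
  rintro ⟨i, h, hi⟩
  exact (isPumpable_of_mem_evalFrom hA hu hy hv).edge_notMem i k h hi

theorem hasIncoming_iff_hasOutgoing_of_notMem_forcedVertices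
    (hA : ∀ w ∈ A.accepts, IsUniversalWord w) (hk : IsInnerVertex k)
    (hkq : k ∉ forcedVertices A q) (hu : q ∈ A.eval u) (hv : v ∈ A.acceptsFrom {q}) :
    HasIncoming u k ↔ HasOutgoing u k := by
  by_contra hne
  refine hkq ⟨hk, fun u' v' hu' hv' => ?_⟩
  have huv := hA _ (append_mem_accepts hu hv)
  have huv_in := huv.not_hasIncoming_right (k := k)
  have huv_out := huv.not_hasOutgoing_right (k := k)
  have huv_iff := huv.hasIncoming_iff_hasOutgoing hk
  have hu'v_iff := (hA _ (append_mem_accepts hu' hv)).hasIncoming_iff_hasOutgoing hk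
  have hu'v'_iff := (hA _ (append_mem_accepts hu' hv')).hasIncoming_iff_hasOutgoing hk
  simp only [hasIncoming_append, hasOutgoing_append] at huv_iff hu'v_iff hu'v'_iff ⊢
  grind

theorem mem_forcedVertices_of_mem_left (hA : ∀ w ∈ A.accepts, IsUniversalWord w)
    (hk : IsInnerVertex k) (hu : q ∈ A.eval u) (hku : OCLetter.a k ∈ u)
    (hin : ¬ HasIncoming u k) : k ∈ forcedVertices A q := by
  refine ⟨hk, fun u' v' _ hv' => ?_⟩
  have hword := (hA _ (append_mem_accepts hu hv')).hasIncoming_of_mem (by simp [hku]) hk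
  rw [hasIncoming_append] at hword ⊢
  exact Or.inr (hword.resolve_left hin)

theorem mem_forcedVertices_of_mem_right (hA : ∀ w ∈ A.accepts, IsUniversalWord w)
    (hk : IsInnerVertex k) (hv : v ∈ A.acceptsFrom {q}) (hkv : OCLetter.a k ∈ v)
    (hin : ¬ HasIncoming v k) : k ∈ forcedVertices A q := by
  refine ⟨hk, fun u' v' hu' _ => ?_⟩
  have hword := (hA _ (append_mem_accepts hu' hv)).hasIncoming_of_mem (by simp [hkv]) hk
  rw [hasIncoming_append] at hword ⊢
  exact Or.inl (hword.resolve_right hin)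

theorem hasOutgoing_of_mem_cycleVertices_before (hA : ∀ w ∈ A.accepts, IsUniversalWord w)
    (hk : IsInnerVertex k) (hkq : k ∉ forcedVertices A q) (hkr : k ∈ cycleVertices A r)
    {u₁ u₂ : List (OCLetter n)} (hu₁ : r ∈ A.eval u₁) (hu₂ : q ∈ A.evalFrom {r} u₂)
    (hv : v ∈ A.acceptsFrom {q}) : HasOutgoing (u₁ ++ u₂) k := by
  obtain ⟨y, hy, hky⟩ := hkr
  rw [← hasIncoming_iff_hasOutgoing_of_notMem_forcedVertices hA hk hkq
    (mem_eval_append hu₁ hu₂) hv]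
  by_contra hin
  have hyin := not_hasIncoming_of_cycle (k := k) hA hu₁ hy (append_mem_acceptsFrom hu₂ hv)
  refine hkq (mem_forcedVertices_of_mem_left hA hk (u := u₁ ++ y ++ u₂)
    (mem_eval_append (mem_eval_append hu₁ hy) hu₂) (by simp [hky]) ?_)
  simp only [hasIncoming_append] at hin ⊢
  tauto

theorem not_hasOutgoing_of_mem_cycleVertices_after (hA : ∀ w ∈ A.accepts, IsUniversalWord w)
    (hk : IsInnerVertex k) (hkq : k ∉ forcedVertices A q) (hkr : k ∈ cycleVertices A r)
    {v₁ v₂ : List (OCLetter n)} (hu : q ∈ A.eval u) (hv₁ : r ∈ A.evalFrom {q} v₁)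
    (hv₂ : v₂ ∈ A.acceptsFrom {r}) : ¬ HasOutgoing u k := by
  obtain ⟨y, hy, hky⟩ := hkr
  have hv := append_mem_acceptsFrom hv₁ hv₂
  rw [← hasIncoming_iff_hasOutgoing_of_notMem_forcedVertices hA hk hkq hu hv]
  intro huin
  have hvin := (hA _ (append_mem_accepts hu hv)).not_hasIncoming_right huin
  have hyin := not_hasIncoming_of_cycle (k := k) hA (mem_eval_append hu hv₁) hy hv₂
  refine hkq (mem_forcedVertices_of_mem_right hA hk (v := v₁ ++ (y ++ v₂))
    (append_mem_acceptsFrom hv₁ (append_mem_acceptsFrom hy hv₂)) (by simp [hky]) ?_)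
  simp only [hasIncoming_append] at hvin ⊢
  tauto

end Forced

section Matching

variable {n : ℕ} {Q : Type*} [Fintype Q] {A : NFA (OCLetter n) Q} {w : List (OCLetter n)}
  {st : ℕ → Q}

theorem vertexCount_even_lt_odd_add_card (hA : ∀ w ∈ A.accepts, IsUniversalWord w)
    (hst : IsAcceptingRun A w st) {E O : Finset (Fin n)} (hE : ∀ i ∈ E, Even (i : ℕ))
    (hO : ∀ i ∈ E, ∀ j, i < j → Odd (j : ℕ) → OCLetter.a j ∈ w →
      (∃ t ≤ w.length, i ∈ cycleVertices A (st t) ∧ j ∈ cycleVertices A (st t)) → j ∈ O) :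
    vertexCount E w < vertexCount O w + Fintype.card Q := by
  let f : ℕ → ℤ := fun i => vertexCount E (w.take i) - vertexCount O (w.take i)
  have hstep : ∀ i < w.length, f (i + 1) ≤ f i + 1 := by
    intro i hi
    have := vertexCount_singleton_le_one E w[i]
    simp only [f, ← List.take_concat_get' w i hi, vertexCount_append]
    omega
  have hrep : ∀ i j, i < j → j ≤ w.length → st i = st j → f j ≤ f i := by
    intro i j hij hj hstate
    let y := (w.take j).drop i
    have hy : st i ∈ A.evalFrom {st i} y := by
      simpa only [← hstate] using hst.mem_evalFrom hij.le hj
    have hyw : y ⊆ w := List.Subset.trans ((w.take j).drop_subset i) (w.take_subset j)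
    have hcycle : vertexCount E y ≤ vertexCount O y :=
      (isPumpable_of_mem_evalFrom hA (hst.mem_eval_take (by omega)) hy
        (hst.drop_mem_acceptsFrom (by omega))).vertexCount_le_of_odd_subset hE
        fun e he hey o heo hodd hoy =>
          hO e he o heo hodd (hyw hoy) ⟨i, by omega, ⟨y, hy, hey⟩, ⟨y, hy, hoy⟩⟩
    have hsplit : w.take j = w.take i ++ y := (take_append_drop_take hij.le).symm
    simp only [f, hsplit, vertexCount_append]
    omega
  have hlt := lt_add_card_of_le_at_repetitions hstep hrep
  simp only [f, List.take_zero, List.take_length, vertexCount, List.count_nil,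
    Finset.sum_const_zero] at hlt ⊢
  omega

theorem exists_injective_cycleVertices (hA : ∀ w ∈ A.accepts, IsUniversalWord w)
    (hst : IsAcceptingRun A w st) {M : ℕ} (hM : Fintype.card Q ≤ M)
    (hcount : ∀ i, OCLetter.a i ∈ w → w.count (OCLetter.a i) = M) :
    ∃ φ : {i : Fin n // Even (i : ℕ) ∧ OCLetter.a i ∈ w} → Fin n, Function.Injective φ ∧
      ∀ i, Odd (φ i : ℕ) ∧ OCLetter.a (φ i) ∈ w ∧ i < φ i ∧
        ∃ t ≤ w.length, ↑i ∈ cycleVertices A (st t) ∧ φ i ∈ cycleVertices A (st t) := by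
  classical
  let IsPartner (i j : Fin n) : Prop := Odd (j : ℕ) ∧ OCLetter.a j ∈ w ∧ i < j ∧
    ∃ t ≤ w.length, i ∈ cycleVertices A (st t) ∧ j ∈ cycleVertices A (st t)
  let partners (i : {i : Fin n // Even (i : ℕ) ∧ OCLetter.a i ∈ w}) : Finset (Fin n) :=
    Finset.univ.filter (IsPartner i)
  suffices hall : ∀ S : Finset _, S.card ≤ (S.biUnion partners).card by
    obtain ⟨φ, hφ, hmem⟩ := (Finset.all_card_le_biUnion_card_iff_exists_injective partners).mp hall
    exact ⟨φ, hφ, fun i => (Finset.mem_filter.mp (hmem i)).2⟩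
  intro S
  let E := S.map (Function.Embedding.subtype _)
  let O := S.biUnion partners
  have hEM : vertexCount E w = E.card * M := Finset.sum_const_nat fun i hi => by
    obtain ⟨e, -, rfl⟩ := Finset.mem_map.mp hi
    exact hcount _ e.2.2
  have hOM : vertexCount O w = O.card * M := Finset.sum_const_nat fun j hj => by
    obtain ⟨e, -, hj⟩ := Finset.mem_biUnion.mp hj
    exact hcount _ (Finset.mem_filter.mp hj).2.2.1
  have hlt : vertexCount E w < vertexCount O w + Fintype.card Q := by
    refine vertexCount_even_lt_odd_add_card hA hst ?_ ?_
    · intro i hi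
      obtain ⟨e, -, rfl⟩ := Finset.mem_map.mp hi
      exact e.2.1
    · intro i hi j hij hodd hjw hcycle
      obtain ⟨e, he, rfl⟩ := Finset.mem_map.mp hi
      exact Finset.mem_biUnion.mpr
        ⟨e, he, Finset.mem_filter.mpr ⟨Finset.mem_univ j, hodd, hjw, hij, hcycle⟩⟩
  rw [hEM, hOM] at hlt
  have hcard : E.card < O.card + 1 :=
    lt_of_mul_lt_mul_right (a := M) (by rw [add_mul]; omega) (Nat.zero_le M)
  rw [Finset.card_map] at hcard
  exact Nat.le_of_lt_succ hcard

end Matching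

section Brackets

/-- The positions of the opening brackets (`s = U`) or of the closing brackets (`s = D`) of a
Dyck word. -/
abbrev BracketPos (σ : DyckWord) (s : DyckStep) : Type :=
  {k : Fin σ.toList.length // σ.toList.get k = s}

theorem card_filter_lt_and_get_eq {α : Type*} [DecidableEq α] (l : List α) (r : ℕ) (a : α) :
    (Finset.univ.filter fun k : Fin l.length => (k : ℕ) < r ∧ l.get k = a).card =
      (l.take r).count a := by
  induction l generalizing r with
  | nil => simp
  | cons b l ih =>
    rcases r with _ | r
    · simp
    · refine (Fin.card_filter_univ_succ (n := l.length) _).trans ?_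
      have hsucc : (Finset.univ.filter fun k : Fin l.length =>
          (k.succ : ℕ) < r + 1 ∧ (b :: l).get k.succ = a).card = (l.take r).count a := by
        simpa using ih r
      rw [List.take_succ_cons, List.count_cons]
      by_cases hb : b = a
      · simpa [hb] using hsucc
      · simpa [hb] using hsucc

theorem card_bracketPos (σ : DyckWord) (s : DyckStep) :
    Fintype.card (BracketPos σ s) = σ.toList.count s := by
  simpa [Fintype.card_subtype] using card_filter_lt_and_get_eq σ.toList σ.toList.length s

variable {σ : DyckWord}

theorem exists_rePairing_of_injective {φ : BracketPos σ .U → BracketPos σ .D}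
    (hφ : Function.Injective φ) (hlt : ∀ k, k.1 < (φ k).1) (τ : BracketPos σ .U → ℕ) :
    ∃ (p : RePairing σ) (e : Fin σ.semilength → BracketPos σ .U),
      Monotone (τ ∘ e) ∧ ∀ i, p.left i = (e i).1 ∧ p.right i = (φ (e i)).1 := by
  let e₀ := (Fintype.equivFinOfCardEq (card_bracketPos σ .U)).symm
  let e := (Tuple.sort (τ ∘ e₀)).trans e₀
  have hφ' : Function.Bijective φ := (Fintype.bijective_iff_injective_and_card φ).mpr
    ⟨hφ, by rw [card_bracketPos, card_bracketPos, σ.count_U_eq_count_D]⟩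
  have hne (k : BracketPos σ .U) (l : BracketPos σ .D) : k.1 ≠ l.1 := fun h =>
    absurd (k.2.symm.trans ((congrArg _ h).trans l.2)) (by decide)
  refine ⟨⟨fun i => (e i).1, fun i => (φ (e i)).1, fun i => (e i).2, fun i => (φ (e i)).2,
    fun i => hlt _, fun b => ?_⟩, e, Tuple.monotone_sort (τ ∘ e₀), fun _ => ⟨rfl, rfl⟩⟩
  rcases DyckStep.dichotomy (σ.toList.get b) with hb | hb
  · refine ⟨e.symm ⟨b, hb⟩, by simp, ?_⟩
    rintro i (hi | hi)
    · exact (Equiv.eq_symm_apply e).mpr (Subtype.ext hi)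
    · exact absurd hi.symm (hne ⟨b, hb⟩ _)
  · obtain ⟨k, hk⟩ := hφ'.2 ⟨b, hb⟩
    refine ⟨e.symm k, by simp [hk], ?_⟩
    rintro i (hi | hi)
    · exact absurd hi (hne _ ⟨b, hb⟩)
    · exact (Equiv.eq_symm_apply e).mpr (hφ ((Subtype.ext hi).trans hk.symm))

end Brackets

section PathVector

variable {n : ℕ}

/-- The vector of the path with vertex list `l` in which the letter `a_i` has multiplicity `x i`. -/
def pathVector (l : List (Fin n)) (x : Fin n → ℕ) : OCLetter n → ℕ
  | .c i j _ => if (i, j) ∈ l.zip l.tail then 1 else 0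
  | .a i => x i

theorem pathVector_mem_universalOneCounterSet {l : List (Fin n)} {x : Fin n → ℕ}
    (hl : l.IsChain (· < ·)) (hs : ∃ s ∈ l.head?, (s : ℕ) = 0)
    (ht : ∃ t ∈ l.getLast?, (t : ℕ) + 1 = n) (hx : IsBalancedVector n x)
    (hxl : ∀ j, 0 < x j → j ∈ l) : pathVector l x ∈ universalOneCounterSet n := by
  refine ⟨⟨fun i j _ => ?_, l, hl, hs, ht, fun i j _ => ?_⟩, hx,
    fun j hj => ⟨fun h => ?_, fun h => ?_⟩⟩
  · exact (ite_eq_or_eq _ _ _).symm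
  · simp [pathVector]
  · obtain ⟨s, hs, hs0⟩ := hs
    obtain ⟨i, hi⟩ := exists_pred_mem_zip_tail (hxl j hj) fun hj' =>
      h.ne' (Option.mem_unique hs hj' ▸ hs0)
    exact ⟨i, lt_of_mem_zip_tail hl hi, if_pos hi⟩
  · obtain ⟨t, ht, htn⟩ := ht
    obtain ⟨i, hi⟩ := exists_succ_mem_zip_tail (hxl j hj) fun hj' =>
      h.ne (Option.mem_unique ht hj' ▸ htn)
    exact ⟨i, lt_of_mem_zip_tail hl hi, if_pos hi⟩

theorem edge_mem_iff_of_count_eq_pathVector {w : List (OCLetter n)} {l : List (Fin n)}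
    {x : Fin n → ℕ} (hw : (fun a => w.count a) = pathVector l x) {i j : Fin n} {h : i < j} :
    OCLetter.c i j h ∈ w ↔ (i, j) ∈ l.zip l.tail := by
  rw [← List.count_pos_iff, congrFun hw (OCLetter.c i j h), pathVector]
  split_ifs with hij <;> simp [hij]

end PathVector

section Placement

variable {n : ℕ} {σ : DyckWord} {pos : Fin σ.toList.length → Fin n}

/-- An assignment of inner vertices to the letters of a Dyck word that preserves the order and
sends opening brackets to even and closing brackets to odd vertices. -/
structure IsPlacement (σ : DyckWord) (pos : Fin σ.toList.length → Fin n) : Prop where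
  strictMono : StrictMono pos
  isInnerVertex : ∀ k, IsInnerVertex (pos k)
  even_iff : ∀ k, Even (pos k : ℕ) ↔ σ.toList.get k = .U

/-- The vertex list of the path from `0` to `n - 1` whose inner vertices are the values of `pos`. -/
def placementPath {N : ℕ} (hn : 2 ≤ n) (pos : Fin N → Fin n) : List (Fin n) :=
  ⟨0, by omega⟩ :: (List.ofFn pos ++ [⟨n - 1, by omega⟩])

open Classical in
/-- The vector that describes the path through the values of `pos` and has every letter `a_i` on
it, except for the ends of the path, with multiplicity `M`. -/
noncomputable def placementVector {N : ℕ} (hn : 2 ≤ n) (pos : Fin N → Fin n) (M : ℕ) :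
    OCLetter n → ℕ :=
  pathVector (placementPath hn pos) fun i => if i ∈ Set.range pos then M else 0

namespace IsPlacement

theorem odd_iff (h : IsPlacement σ pos) (k : Fin σ.toList.length) :
    Odd (pos k : ℕ) ↔ σ.toList.get k = .D := by
  rw [← Nat.not_even_iff_odd, h.even_iff]
  cases σ.toList.get k <;> decide

theorem exists_le_iff_lt (h : IsPlacement σ pos) (m : Fin n) :
    ∃ r : ℕ, ∀ k, pos k ≤ m ↔ (k : ℕ) < r := by
  have hlower : IsLowerSet {k | pos k ≤ m} := fun k l hlk hk =>
    (h.strictMono.monotone hlk).trans hk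
  rcases hlower.eq_univ_or_Iio with huniv | ⟨r, hr⟩
  · exact ⟨σ.toList.length, fun k => by simpa using Set.ext_iff.mp huniv k⟩
  · exact ⟨r, fun k => Set.ext_iff.mp hr k⟩

open Classical in
theorem sum_filter_eq (h : IsPlacement σ pos) (M : ℕ) {T : Finset (Fin n)} {r : ℕ}
    (hT : ∀ k, pos k ∈ T ↔ (k : ℕ) < r) (P : Fin n → Prop)
    [DecidablePred P] {s : DyckStep} (hP : ∀ k, P (pos k) ↔ σ.toList.get k = s) :
    ∑ i ∈ T.filter P, (if i ∈ Set.range pos then M else 0) = (σ.toList.take r).count s * M := by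
  rw [← Finset.sum_filter, Finset.sum_const, smul_eq_mul, ← card_filter_lt_and_get_eq,
    ← Finset.card_image_of_injective _ h.strictMono.injective]
  congr 2
  ext i
  simp only [Finset.mem_filter, Finset.mem_image, Finset.mem_univ, true_and, ← hT, ← hP]
  constructor
  · rintro ⟨⟨hi, hiP⟩, k, rfl⟩
    exact ⟨k, ⟨hi, hiP⟩, rfl⟩
  · rintro ⟨k, ⟨hi, hiP⟩, rfl⟩
    exact ⟨⟨hi, hiP⟩, k, rfl⟩

open Classical in
theorem alternating_sum_eq (h : IsPlacement σ pos) (M : ℕ) {T : Finset (Fin n)} {r : ℕ}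
    (hT : ∀ k, pos k ∈ T ↔ (k : ℕ) < r) :
    ∑ i ∈ T, (-1 : ℤ) ^ (i : ℕ) * ((if i ∈ Set.range pos then M else 0 : ℕ) : ℤ) =
      ((σ.toList.take r).count .U * M : ℕ) - ((σ.toList.take r).count .D * M : ℕ) := by
  rw [sum_alternating_eq_sum_even_sub_sum_odd, h.sum_filter_eq M hT (Even ·.val) h.even_iff,
    h.sum_filter_eq M hT (Odd ·.val) h.odd_iff]

open Classical in
theorem isBalancedVector (h : IsPlacement σ pos) (M : ℕ) :
    IsBalancedVector n fun i => if i ∈ Set.range pos then M else 0 := by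
  constructor
  · rw [h.alternating_sum_eq M (r := σ.toList.length) (by simp), List.take_length,
      σ.count_U_eq_count_D, sub_self]
  · intro m _
    obtain ⟨r, hr⟩ := h.exists_le_iff_lt m
    rw [h.alternating_sum_eq M (r := r) (by simpa using hr), sub_nonneg, Nat.cast_le]
    exact Nat.mul_le_mul_right M (σ.count_D_le_count_U r)

theorem isChain_placementPath (h : IsPlacement σ pos) (hn : 2 ≤ n) :
    (placementPath hn pos).IsChain (· < ·) := by
  rw [List.isChain_iff_pairwise, placementPath, List.pairwise_cons, List.pairwise_append,
    List.pairwise_ofFn]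
  refine ⟨?_, fun i j hij => h.strictMono hij, List.pairwise_singleton _ _, ?_⟩
  · simp only [List.mem_append, List.mem_ofFn, List.mem_singleton, Fin.lt_def]
    rintro a (⟨k, rfl⟩ | rfl)
    · exact (h.isInnerVertex k).1
    · dsimp only
      omega
  · simp only [List.mem_ofFn, List.mem_singleton, Fin.lt_def]
    rintro _ ⟨k, rfl⟩ _ rfl
    exact Nat.lt_sub_of_add_lt (h.isInnerVertex k).2

theorem placementVector_mem_universalOneCounterSet (h : IsPlacement σ pos) (hn : 2 ≤ n) (M : ℕ) :
    placementVector hn pos M ∈ universalOneCounterSet n := by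
  refine pathVector_mem_universalOneCounterSet (h.isChain_placementPath hn)
    ⟨⟨0, by omega⟩, by simp [placementPath], rfl⟩
    ⟨⟨n - 1, by omega⟩, by simp [placementPath, List.getLast?_cons], by dsimp only; omega⟩
    (h.isBalancedVector M) fun j hj => ?_
  obtain ⟨k, rfl⟩ : j ∈ Set.range pos := by
    by_contra hj'
    simp [hj'] at hj
  simp [placementPath]

end IsPlacement

section PlacementWords

variable {hn : 2 ≤ n} {M : ℕ} {w : List (OCLetter n)}

theorem count_vertex_of_placementVector (hw : (fun a => w.count a) = placementVector hn pos M)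
    (k : Fin σ.toList.length) : w.count (OCLetter.a (pos k)) = M :=
  (congrFun hw (OCLetter.a (pos k))).trans (if_pos ⟨k, rfl⟩)

theorem mem_range_of_vertex_mem (hw : (fun a => w.count a) = placementVector hn pos M)
    {j : Fin n} (hj : OCLetter.a j ∈ w) : j ∈ Set.range pos := by
  by_contra hj'
  exact (List.count_pos_iff.mpr hj).ne' ((congrFun hw (OCLetter.a j)).trans (if_neg hj'))

theorem mem_range_of_hasIncoming (hw : (fun a => w.count a) = placementVector hn pos M)
    {k : Fin n} (hk : IsInnerVertex k) (hin : HasIncoming w k) : k ∈ Set.range pos := by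
  obtain ⟨i, h, hi⟩ := hin
  have hmem := List.mem_of_mem_tail
    (List.of_mem_zip ((edge_mem_iff_of_count_eq_pathVector hw).mp hi)).2
  simp only [placementPath, List.mem_cons, List.mem_append, List.mem_ofFn, List.not_mem_nil,
    or_false] at hmem
  rcases hmem with rfl | hmem | rfl
  · exact absurd hk.1 (lt_irrefl 0)
  · exact hmem
  · exact absurd hk.2 (by dsimp only; omega)

theorem IsPlacement.hasOutgoing_iff_hasIncoming_succ (h : IsPlacement σ pos)
    (hw : (fun a => w.count a) = placementVector hn pos M) {u : List (OCLetter n)} (huw : u ⊆ w)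
    {k : ℕ} (hk : k + 1 < σ.toList.length) :
    HasOutgoing u (pos ⟨k, by omega⟩) ↔ HasIncoming u (pos ⟨k + 1, hk⟩) := by
  have hchain := h.isChain_placementPath hn
  have hedge : (pos ⟨k, by omega⟩, pos ⟨k + 1, hk⟩) ∈
      (placementPath hn pos).zip (placementPath hn pos).tail :=
    mem_zip_tail_iff.mpr ⟨k + 1, by simp [placementPath]; omega,
      by simp [placementPath, Nat.lt_of_succ_lt hk], by simp [placementPath, hk]⟩
  constructor
  · rintro ⟨j, hj, hju⟩
    obtain rfl := succ_unique_of_mem_zip_tail hchain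
      ((edge_mem_iff_of_count_eq_pathVector hw).mp (huw hju)) hedge
    exact ⟨_, hj, hju⟩
  · rintro ⟨i, hi, hiu⟩
    obtain rfl := pred_unique_of_mem_zip_tail hchain
      ((edge_mem_iff_of_count_eq_pathVector hw).mp (huw hiu)) hedge
    exact ⟨_, hi, hiu⟩

end PlacementWords

end Placement

section WidthBound

variable {n M : ℕ} {hn : 2 ≤ n} {σ : DyckWord} {pos : Fin σ.toList.length → Fin n} {Q : Type*}
  {A : NFA (OCLetter n) Q} {w : List (OCLetter n)} {st : ℕ → Q}

namespace IsPlacement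

theorem exists_matching [Fintype Q] (h : IsPlacement σ pos)
    (hA : ∀ w ∈ A.accepts, IsUniversalWord w) (hst : IsAcceptingRun A w st)
    (hM : Fintype.card Q ≤ M) (hw : (fun a => w.count a) = placementVector hn pos M) :
    ∃ φ : BracketPos σ .U → BracketPos σ .D, Function.Injective φ ∧ ∀ k, k.1 < (φ k).1 ∧
      ∃ t ≤ w.length,
        pos k.1 ∈ cycleVertices A (st t) ∧ pos (φ k).1 ∈ cycleVertices A (st t) := by
  have hM0 : 0 < M := (Fintype.card_pos_iff.mpr ⟨st 0⟩).trans_le hM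
  have vertex_mem (k) : OCLetter.a (pos k) ∈ w :=
    List.count_pos_iff.mp (count_vertex_of_placementVector hw k ▸ hM0)
  obtain ⟨ψ, hψ, hψ_spec⟩ := exists_injective_cycleVertices hA hst hM fun i hi => by
    obtain ⟨k, rfl⟩ := mem_range_of_vertex_mem hw hi
    exact count_vertex_of_placementVector hw k
  let vertex (k : BracketPos σ .U) : {i : Fin n // Even (i : ℕ) ∧ OCLetter.a i ∈ w} :=
    ⟨pos k.1, (h.even_iff k.1).mpr k.2, vertex_mem k.1⟩
  have exists_bracket : ∀ k, ∃ l : BracketPos σ .D, pos l.1 = ψ (vertex k) := by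
    intro k
    obtain ⟨hodd, hmem, -⟩ := hψ_spec (vertex k)
    obtain ⟨l, hl⟩ := mem_range_of_vertex_mem hw hmem
    exact ⟨⟨l, (h.odd_iff l).mp (hl ▸ hodd)⟩, hl⟩
  choose φ hφ using exists_bracket
  refine ⟨φ, fun k l hkl => ?_, fun k => ?_⟩
  · have hvertex : vertex k = vertex l := hψ (by rw [← hφ, ← hφ, hkl])
    exact Subtype.ext (h.strictMono.injective (congrArg Subtype.val hvertex))
  · obtain ⟨-, -, hlt, hcycle⟩ := hψ_spec (vertex k)
    rw [← hφ] at hlt hcycle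
    exact ⟨h.strictMono.lt_iff_lt.mp hlt, hcycle⟩

theorem exists_rePairing [Fintype Q] (h : IsPlacement σ pos)
    (hA : ∀ w ∈ A.accepts, IsUniversalWord w) (hst : IsAcceptingRun A w st)
    (hM : Fintype.card Q ≤ M) (hw : (fun a => w.count a) = placementVector hn pos M) :
    ∃ (p : RePairing σ) (τ : Fin σ.semilength → ℕ), Monotone τ ∧ ∀ i, τ i ≤ w.length ∧
      pos (p.left i) ∈ cycleVertices A (st (τ i)) ∧
      pos (p.right i) ∈ cycleVertices A (st (τ i)) := by
  obtain ⟨φ, hφ, hφ_spec⟩ := h.exists_matching hA hst hM hw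
  choose hlt τ hτ using hφ_spec
  obtain ⟨p, e, hmono, hp⟩ := exists_rePairing_of_injective hφ hlt τ
  refine ⟨p, τ ∘ e, hmono, fun i => ?_⟩
  rw [(hp i).1, (hp i).2]
  exact hτ (e i)

theorem mem_erased_iff_hasOutgoing (h : IsPlacement σ pos)
    (hA : ∀ w ∈ A.accepts, IsUniversalWord w) (hst : IsAcceptingRun A w st) {p : RePairing σ}
    {τ : Fin σ.semilength → ℕ} (hτ : Monotone τ)
    (hp : ∀ i, τ i ≤ w.length ∧ pos (p.left i) ∈ cycleVertices A (st (τ i)) ∧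
      pos (p.right i) ∈ cycleVertices A (st (τ i)))
    {j : Fin σ.semilength} {k : Fin σ.toList.length}
    (hk : pos k ∉ forcedVertices A (st (τ j))) :
    (k : ℕ) ∈ p.erased (j + 1) ↔ HasOutgoing (w.take (τ j)) (pos k) := by
  obtain ⟨i, hi, -⟩ := p.existsUnique_pair k
  have hcycle : pos k ∈ cycleVertices A (st (τ i)) := by
    rcases hi with rfl | rfl
    exacts [(hp i).2.1, (hp i).2.2]
  rw [p.mem_erased_iff hi, Nat.lt_succ_iff, Fin.val_fin_le]
  rcases le_or_gt i j with hij | hji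
  · have hout := hasOutgoing_of_mem_cycleVertices_before hA (h.isInnerVertex k) hk hcycle
      (hst.mem_eval_take (hp i).1) (hst.mem_evalFrom (hτ hij) (hp j).1)
      (hst.drop_mem_acceptsFrom (hp j).1)
    exact iff_of_true hij (take_append_drop_take (w := w) (hτ hij) ▸ hout)
  · exact iff_of_false hji.not_ge (not_hasOutgoing_of_mem_cycleVertices_after hA
      (h.isInnerVertex k) hk hcycle (hst.mem_eval_take (hp j).1)
      (hst.mem_evalFrom (hτ hji.le) (hp i).1) (hst.drop_mem_acceptsFrom (hp i).1))

theorem setWidth_erased_le (h : IsPlacement σ pos)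
    (hA : ∀ w ∈ A.accepts, IsUniversalWord w) (hst : IsAcceptingRun A w st)
    (hw : (fun a => w.count a) = placementVector hn pos M) {p : RePairing σ} {t T : ℕ}
    (hT : T ≤ w.length)
    (hp : ∀ k, pos k ∉ forcedVertices A (st T) →
      ((k : ℕ) ∈ p.erased t ↔ HasOutgoing (w.take T) (pos k))) :
    setWidth (p.erased t) ≤ 2 * (forcedVertices A (st T)).ncard + 1 := by
  classical
  let K := (Finset.univ.filter fun k => pos k ∈ forcedVertices A (st T)).map Fin.valEmbedding
  have hKcard : K.card ≤ (forcedVertices A (st T)).ncard := by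
    rw [Finset.card_map, ← Finset.card_image_of_injective _ h.strictMono.injective,
      ← Set.ncard_coe_finset]
    refine Set.ncard_le_ncard (fun i hi => ?_) (Set.toFinite _)
    obtain ⟨k, hk, rfl⟩ := Finset.mem_image.mp hi
    exact (Finset.mem_filter.mp hk).2
  have notMem_forced (k : Fin σ.toList.length) (hk : (k : ℕ) ∉ K) :
      pos k ∉ forcedVertices A (st T) := fun hk' =>
    hk (Finset.mem_map.mpr ⟨k, Finset.mem_filter.mpr ⟨Finset.mem_univ k, hk'⟩, rfl⟩)
  have hwidth : setWidth (p.erased t) ≤ 2 * K.card + 1 := by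
    refine setWidth_le_two_mul_card_add_one (p.bddAbove_erased t) fun k hk hk1 hmem => ?_
    have hkN : k + 1 < σ.toList.length := by
      obtain ⟨i, -, hi | hi⟩ := hmem <;> exact hi ▸ Fin.is_lt _
    have hforced := notMem_forced ⟨k, by omega⟩ hk
    have hforced1 := notMem_forced ⟨k + 1, hkN⟩ hk1
    refine (hp _ hforced).mpr ((h.hasOutgoing_iff_hasIncoming_succ hw (w.take_subset T) hkN).mpr ?_)
    exact (hasIncoming_iff_hasOutgoing_of_notMem_forcedVertices hA (h.isInnerVertex _) hforced1
      (hst.mem_eval_take hT) (hst.drop_mem_acceptsFrom hT)).mpr ((hp _ hforced1).mp hmem)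
  omega

theorem exists_width_le_two_mul_ncard_forcedVertices_add_one [Fintype Q] (h : IsPlacement σ pos)
    (hA : ∀ w ∈ A.accepts, IsUniversalWord w) (hst : IsAcceptingRun A w st)
    (hM : Fintype.card Q ≤ M) (hw : (fun a => w.count a) = placementVector hn pos M) :
    ∃ T ≤ w.length, σ.width ≤ 2 * (forcedVertices A (st T)).ncard + 1 := by
  obtain ⟨p, τ, hτ, hp⟩ := h.exists_rePairing hA hst hM hw
  obtain ⟨t, ht, hwidth⟩ := p.exists_width_le_setWidth_erased
  obtain ⟨T, hT, hbound⟩ : ∃ T ≤ w.length,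
      setWidth (p.erased t) ≤ 2 * (forcedVertices A (st T)).ncard + 1 := by
    rcases t with _ | j
    · exact ⟨0, Nat.zero_le _, h.setWidth_erased_le hA hst hw (Nat.zero_le _) fun k _ => by
        simp [RePairing.erased, HasOutgoing]⟩
    · exact ⟨τ ⟨j, ht⟩, (hp _).1, h.setWidth_erased_le hA hst hw (hp _).1 fun k hk =>
        h.mem_erased_iff_hasOutgoing hA hst hτ hp hk⟩
  exact ⟨T, hT, hwidth.trans hbound⟩

theorem exists_forcedVertices_subset_range [Fintype Q] (h : IsPlacement σ pos)
    (hA : ∀ w ∈ A.accepts, IsUniversalWord w) (hM : Fintype.card Q ≤ M)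
    (hwA : w ∈ A.accepts) (hw : (fun a => w.count a) = placementVector hn pos M) :
    ∃ q, forcedVertices A q ⊆ Set.range pos ∧ σ.width / 2 ≤ (forcedVertices A q).ncard := by
  obtain ⟨st, hst⟩ := exists_isAcceptingRun hwA
  obtain ⟨T, hT, hwidth⟩ :=
    h.exists_width_le_two_mul_ncard_forcedVertices_add_one hA hst hM hw
  refine ⟨st T, fun k ⟨hk, hforced⟩ => mem_range_of_hasIncoming hw hk ?_, by omega⟩
  exact w.take_append_drop T ▸ hforced _ _ (hst.mem_eval_take hT) (hst.drop_mem_acceptsFrom hT)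

end IsPlacement

end WidthBound

theorem card_le_pow_of_eqOn {ι β : Type*} [Fintype ι] [Fintype β] {X : Finset (ι → β)}
    {J : Finset ι} {e₀ : ι → β} (hX : ∀ e ∈ X, ∀ k ∈ J, e k = e₀ k) :
    X.card ≤ Fintype.card β ^ (Fintype.card ι - J.card) := by
  classical
  have hinj : Set.InjOn (fun (e : ι → β) (k : {k // k ∉ J}) => e k) X := by
    intro e he e' he' hee'
    funext k
    by_cases hk : k ∈ J
    · rw [hX e he k hk, hX e' he' k hk]
    · exact congrFun hee' ⟨k, hk⟩
  calc X.card ≤ (Finset.univ : Finset ({k // k ∉ J} → β)).card :=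
        Finset.card_le_card_of_injOn _ (fun _ _ => Finset.mem_univ _) hinj
    _ = Fintype.card β ^ (Fintype.card ι - J.card) := by simp [Fintype.card_subtype_compl]

section BlockPlacement

variable {n b : ℕ} {σ : DyckWord} {e e' : Fin σ.toList.length → Fin b}
  {k l : Fin σ.toList.length}

/-- The assignment of vertices that divides the vertices from `2` on into blocks of `2 * b`
consecutive ones and sends the `k`-th letter of the Dyck word into the `k`-th block, to the
`e k`-th vertex of the parity required by `IsPlacement`. -/
def blockPlacement (hb : 2 * (σ.toList.length * b) + 2 < n) (e : Fin σ.toList.length → Fin b)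
    (k : Fin σ.toList.length) : Fin n :=
  ⟨2 + 2 * (k * b + e k) + if σ.toList.get k = .U then 0 else 1, by
    have hblock : ((k : ℕ) + 1) * b ≤ σ.toList.length * b := Nat.mul_le_mul_right b k.2
    have := (e k).2
    rw [add_mul, one_mul] at hblock
    split_ifs <;> omega⟩

theorem val_blockPlacement (hb : 2 * (σ.toList.length * b) + 2 < n) :
    (blockPlacement hb e k : ℕ) =
      2 + 2 * (k * b + e k) + if σ.toList.get k = .U then 0 else 1 :=
  rfl

theorem isPlacement_blockPlacement (hb : 2 * (σ.toList.length * b) + 2 < n)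
    (e : Fin σ.toList.length → Fin b) : IsPlacement σ (blockPlacement hb e) where
  strictMono k l hkl := by
    have hblock : ((k : ℕ) + 1) * b ≤ l * b := Nat.mul_le_mul_right b hkl
    have := (e k).2
    rw [add_mul, one_mul] at hblock
    rw [Fin.lt_def, val_blockPlacement, val_blockPlacement]
    split_ifs <;> omega
  isInnerVertex k := by
    have hblock : ((k : ℕ) + 1) * b ≤ σ.toList.length * b := Nat.mul_le_mul_right b k.2
    have := (e k).2
    rw [add_mul, one_mul] at hblock
    rw [IsInnerVertex, val_blockPlacement]
    split_ifs <;> omega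
  even_iff k := by
    rw [val_blockPlacement, Nat.even_iff]
    split_ifs with hk <;> simp only [hk, iff_true, iff_false] <;> omega

theorem eq_of_blockPlacement_eq (hb : 2 * (σ.toList.length * b) + 2 < n)
    (h : blockPlacement hb e k = blockPlacement hb e' l) : k = l ∧ e k = e' l := by
  have hb0 : 0 < b := (e k).pos
  have hval : (e k : ℕ) + b * k = e' l + b * l := by
    have := congrArg Fin.val h
    rw [val_blockPlacement, val_blockPlacement] at this
    rw [mul_comm b, mul_comm b]
    split_ifs at this <;> omega
  have hkl : (k : ℕ) = l := by
    simpa [Nat.add_mul_div_left, hb0, Nat.div_eq_of_lt] using congrArg (· / b) hval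
  rw [hkl, Nat.add_right_cancel_iff] at hval
  exact ⟨Fin.ext hkl, Fin.ext hval⟩

theorem card_le_pow_of_subset_range_blockPlacement (hb : 2 * (σ.toList.length * b) + 2 < n)
    {F : Set (Fin n)} {X : Finset (Fin σ.toList.length → Fin b)}
    (hX : ∀ e ∈ X, F ⊆ Set.range (blockPlacement hb e)) :
    X.card ≤ b ^ (σ.toList.length - F.ncard) := by
  classical
  rcases X.eq_empty_or_nonempty with rfl | ⟨e₀, he₀⟩
  · exact Nat.zero_le _
  let J : Finset (Fin σ.toList.length) := Finset.univ.filter (blockPlacement hb e₀ · ∈ F)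
  have hJ : J.card = F.ncard := by
    rw [← Set.ncard_preimage_of_injective_subset_range
      (isPlacement_blockPlacement hb e₀).strictMono.injective (hX e₀ he₀), ← Set.ncard_coe_finset]
    congr 1
    ext k
    simp [J]
  have hagree : ∀ e ∈ X, ∀ k ∈ J, e k = e₀ k := by
    intro e he k hk
    obtain ⟨l, hl⟩ := hX e he (Finset.mem_filter.mp hk).2
    obtain ⟨rfl, hel⟩ := eq_of_blockPlacement_eq hb hl
    exact hel
  simpa [hJ] using card_le_pow_of_eqOn hagree

end BlockPlacement

section StateBounds

variable {n : ℕ} {Q : Type*} {A : NFA (OCLetter n) Q}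

theorem isUniversalWord_of_mem_accepts (hP : parikhImage A.accepts = universalOneCounterSet n) :
    ∀ w ∈ A.accepts, IsUniversalWord w := fun w hw =>
  hP.subset ⟨w, hw, rfl⟩

theorem exists_mem_accepts_of_mem (hP : parikhImage A.accepts = universalOneCounterSet n)
    {x : OCLetter n → ℕ} (hx : x ∈ universalOneCounterSet n) :
    ∃ w ∈ A.accepts, (fun a => w.count a) = x := by
  obtain ⟨w, hw, rfl⟩ := hP.superset hx
  exact ⟨w, hw, rfl⟩

variable [Fintype Q]

theorem pow_le_card_states {σ : DyckWord} {b : ℕ}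
    (hP : parikhImage A.accepts = universalOneCounterSet n)
    (hb : 2 * (σ.toList.length * b) + 2 < n) (hb0 : 0 < b) :
    b ^ (σ.width / 2) ≤ Fintype.card Q := by
  classical
  set N := σ.toList.length
  set s := σ.width / 2
  have exists_state (e : Fin N → Fin b) : ∃ q,
      forcedVertices A q ⊆ Set.range (blockPlacement hb e) ∧ s ≤ (forcedVertices A q).ncard := by
    have he := isPlacement_blockPlacement hb e
    obtain ⟨w, hwA, hw⟩ := exists_mem_accepts_of_mem hP
      (he.placementVector_mem_universalOneCounterSet (by omega) (Fintype.card Q))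
    exact he.exists_forcedVertices_subset_range (isUniversalWord_of_mem_accepts hP) le_rfl hwA hw
  choose q hrange hcard using exists_state
  have hfiber : ∀ r ∈ Finset.univ.image q,
      (Finset.univ.filter fun e => q e = r).card ≤ b ^ (N - s) := by
    intro r hr
    obtain ⟨e₀, -, rfl⟩ := Finset.mem_image.mp hr
    have hcommon : ∀ e ∈ Finset.univ.filter fun e => q e = q e₀,
        forcedVertices A (q e₀) ⊆ Set.range (blockPlacement hb e) := fun e he =>
      (Finset.mem_filter.mp he).2 ▸ hrange e
    exact (card_le_pow_of_subset_range_blockPlacement hb hcommon).trans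
      (Nat.pow_le_pow_right hb0 (Nat.sub_le_sub_left (hcard e₀) N))
  have hsN : s ≤ N := by
    let e₀ : Fin N → Fin b := fun _ => ⟨0, hb0⟩
    have hF := Set.ncard_le_ncard (hrange e₀) (Set.toFinite _)
    rw [Set.ncard_range_of_injective (isPlacement_blockPlacement hb e₀).strictMono.injective,
      Nat.card_fin] at hF
    exact (hcard e₀).trans hF
  have htotal : b ^ (N - s) * b ^ s ≤ b ^ (N - s) * Fintype.card Q := by
    rw [← pow_add, Nat.sub_add_cancel hsN]
    calc b ^ N = (Finset.univ : Finset (Fin N → Fin b)).card := by simp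
      _ ≤ b ^ (N - s) * (Finset.univ.image q).card :=
        Finset.card_le_mul_card_image _ _ hfiber
      _ ≤ b ^ (N - s) * Fintype.card Q := Nat.mul_le_mul_left _ (Finset.card_le_univ _)
  exact Nat.le_of_mul_le_mul_left htotal (Nat.pow_pos hb0)

theorem length_lt_card_states (hA : ∀ w ∈ A.accepts, IsUniversalWord w) {w : List (OCLetter n)}
    (hwA : w ∈ A.accepts) (hvertex : ∀ k, OCLetter.a k ∉ w) : w.length < Fintype.card Q := by
  obtain ⟨st, hst⟩ := exists_isAcceptingRun hwA
  have hrep : ∀ i j, i < j → j ≤ w.length → st i = st j → (j : ℤ) ≤ i := by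
    intro i j hij hj hstate
    have hpump := isPumpable_of_mem_evalFrom hA (hst.mem_eval_take (by omega))
      (by simpa only [← hstate] using hst.mem_evalFrom hij.le hj)
      (hst.drop_mem_acceptsFrom (by omega))
    have hempty : (w.take j).drop i = [] := by
      refine List.eq_nil_iff_forall_not_mem.mpr ?_
      rintro (⟨i', j', h⟩ | k) hmem
      · exact hpump.edge_notMem i' j' h hmem
      · exact hvertex k (List.mem_of_mem_take (List.mem_of_mem_drop hmem))
    rw [List.drop_eq_nil_iff, List.length_take_of_le hj] at hempty
    exact_mod_cast hempty
  simpa using lt_add_card_of_le_at_repetitions (f := fun i => (i : ℤ)) (by simp) hrep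

theorem pathVector_finRange_mem_universalOneCounterSet (hn : 2 ≤ n) :
    pathVector (List.finRange n) 0 ∈ universalOneCounterSet n := by
  refine pathVector_mem_universalOneCounterSet ?_ ⟨⟨0, by omega⟩, ?_, rfl⟩
    ⟨⟨n - 1, by omega⟩, ?_, by dsimp only; omega⟩ ⟨by simp, by simp⟩ (by simp)
  · exact List.isChain_iff_pairwise.mpr (List.pairwise_lt_finRange n)
  · simp [List.head?_eq_getElem?, show 0 < n by omega]
  · simp [List.getLast?_eq_getElem?, show n - 1 < n by omega]

theorem le_card_states (hP : parikhImage A.accepts = universalOneCounterSet n) (hn : 2 ≤ n) :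
    n ≤ Fintype.card Q := by
  classical
  obtain ⟨w, hwA, hw⟩ := exists_mem_accepts_of_mem hP
    (pathVector_finRange_mem_universalOneCounterSet hn)
  have hlt := length_lt_card_states (isUniversalWord_of_mem_accepts hP) hwA fun k =>
    List.count_eq_zero.mp (congrFun hw (OCLetter.a k))
  let edge : Fin (n - 1) → OCLetter n := fun m =>
    OCLetter.c ⟨m, by omega⟩ ⟨m + 1, by omega⟩ (Nat.lt_succ_self m)
  have hedge : Function.Injective edge := fun m m' h => by
    simpa [edge, Fin.ext_iff] using h
  have edge_mem (m) : edge m ∈ w :=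
    (edge_mem_iff_of_count_eq_pathVector hw).mpr
      (mem_zip_tail_iff.mpr ⟨m, by simp; omega, by simp, by simp⟩)
  have hlength : n - 1 ≤ w.length :=
    calc n - 1 = (Finset.univ.image edge).card := by
          rw [Finset.card_image_of_injective _ hedge, Finset.card_fin]
      _ ≤ w.toFinset.card := Finset.card_le_card fun x hx => by
          obtain ⟨m, -, rfl⟩ := Finset.mem_image.mp hx
          exact List.mem_toFinset.mpr (edge_mem m)
      _ ≤ w.length := w.toFinset_card_le
  omega

end StateBounds

section Exponents

variable {C β : ℝ}

theorem two_mul_mul_ceil_rpow_add_two_lt (hβ₀ : 0 ≤ β) {n L : ℕ} (hn : 1 ≤ n)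
    (hL : (L : ℝ) ≤ C * (n : ℝ) ^ β) (hC : 0 ≤ C)
    (hlarge : 4 * C + 2 < (n : ℝ) ^ ((1 - β) / 2)) :
    2 * (L * ⌈(n : ℝ) ^ ((1 - β) / 2)⌉₊) + 2 < n := by
  set x := (n : ℝ) ^ ((1 - β) / 2)
  set y := (n : ℝ) ^ ((1 + β) / 2)
  have hn0 : (0 : ℝ) < n := by exact_mod_cast hn
  have hy : 1 ≤ y := Real.one_le_rpow (by exact_mod_cast hn) (by linarith)
  have hpow : (n : ℝ) ^ β * x = y := by
    rw [← Real.rpow_add hn0, show β + (1 - β) / 2 = (1 + β) / 2 by ring]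
  have hxy : x * y = n := by
    rw [← Real.rpow_add hn0, ← add_div, sub_add_add_cancel, one_add_one_eq_two,
      div_self two_ne_zero, Real.rpow_one]
  have hceil : (⌈x⌉₊ : ℝ) ≤ 2 * x := by
    have := Nat.ceil_lt_add_one (a := x) (by positivity)
    linarith
  suffices h : 2 * ((L : ℝ) * ⌈x⌉₊) + 2 < n by exact_mod_cast h
  calc 2 * ((L : ℝ) * ⌈x⌉₊) + 2 ≤ 2 * (C * (n : ℝ) ^ β * (2 * x)) + 2 * y := by
        gcongr
        linarith
    _ = (4 * C + 2) * y := by rw [← hpow]; ring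
    _ < x * y := by gcongr
    _ = n := hxy

theorem rpow_mul_le_of_forall_pow_le {ε c : ℝ} {n L W K : ℕ} (hn : 1 ≤ n) (hε : 0 ≤ ε)
    (hcε : c ≤ ε / 3) (hW : 2 ≤ W) (hb : 2 * (L * ⌈(n : ℝ) ^ ε⌉₊) + 2 < n)
    (hpow : ∀ b, 0 < b → 2 * (L * b) + 2 < n → b ^ (W / 2) ≤ K) :
    (n : ℝ) ^ (c * W) ≤ K := by
  have hexp : c * W ≤ ε * (W / 2 : ℕ) := by
    have hthird : (W : ℝ) ≤ 3 * (W / 2 : ℕ) := by exact_mod_cast (by omega : W ≤ 3 * (W / 2))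
    nlinarith
  have hceil : 0 < ⌈(n : ℝ) ^ ε⌉₊ := Nat.ceil_pos.mpr (by positivity)
  calc (n : ℝ) ^ (c * W) ≤ (n : ℝ) ^ (ε * (W / 2 : ℕ)) :=
        Real.rpow_le_rpow_of_exponent_le (by exact_mod_cast hn) hexp
    _ = ((n : ℝ) ^ ε) ^ (W / 2) := by rw [Real.rpow_mul (by positivity), Real.rpow_natCast]
    _ ≤ (⌈(n : ℝ) ^ ε⌉₊ : ℝ) ^ (W / 2) := by gcongr; exact Nat.le_ceil _
    _ ≤ K := by exact_mod_cast hpow _ hceil hb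

theorem exists_pos_rpow_mul_le (hC : 0 < C) (hβ₀ : 0 ≤ β) (hβ₁ : β < 1) :
    ∃ c : ℝ, 0 < c ∧ ∀ n L W K : ℕ, 1 ≤ n → (L : ℝ) ≤ C * (n : ℝ) ^ β → W ≤ L → n ≤ K →
      (∀ b, 0 < b → 2 * (L * b) + 2 < n → b ^ (W / 2) ≤ K) → (n : ℝ) ^ (c * W) ≤ K := by
  set ε := (1 - β) / 2 with hε
  have hε0 : 0 < ε := by linarith
  let D := C * ((4 * C + 2) ^ ε⁻¹) ^ β + 1
  have hD : 0 < D := by positivity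
  refine ⟨min (ε / 3) D⁻¹, by positivity, fun n L W K hn hL hWL hnK hpow => ?_⟩
  set c := min (ε / 3) D⁻¹
  have hn1 : (1 : ℝ) ≤ n := by exact_mod_cast hn
  have le_of_exponent_le_one (hexp : c * W ≤ 1) : (n : ℝ) ^ (c * W) ≤ K :=
    calc (n : ℝ) ^ (c * W) ≤ (n : ℝ) ^ (1 : ℝ) := Real.rpow_le_rpow_of_exponent_le hn1 hexp
      _ ≤ K := by rw [Real.rpow_one]; exact_mod_cast hnK
  rcases le_or_gt ((n : ℝ) ^ ε) (4 * C + 2) with hsmall | hlarge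
  · refine le_of_exponent_le_one ?_
    have hnle : (n : ℝ) ≤ (4 * C + 2) ^ ε⁻¹ :=
      (Real.le_rpow_inv_iff_of_pos (by positivity) (by positivity) hε0).mpr hsmall
    have hWD : (W : ℝ) ≤ D :=
      calc (W : ℝ) ≤ L := by exact_mod_cast hWL
        _ ≤ C * (n : ℝ) ^ β := hL
        _ ≤ C * ((4 * C + 2) ^ ε⁻¹) ^ β := by gcongr
        _ ≤ D := by simp only [D]; linarith
    calc c * W ≤ D⁻¹ * D := by gcongr; exact min_le_right _ _
      _ = 1 := inv_mul_cancel₀ hD.ne'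
  rcases Nat.lt_or_ge W 2 with hW | hW
  · refine le_of_exponent_le_one ?_
    have hW1 : (W : ℝ) ≤ 1 := by exact_mod_cast Nat.le_of_lt_succ hW
    have hc1 : c ≤ 1 := (min_le_left _ _).trans (by linarith)
    exact mul_le_one₀ hc1 (Nat.cast_nonneg W) hW1
  · exact rpow_mul_le_of_forall_pow_le hn hε0.le (min_le_left _ _) hW
      (two_mul_mul_ceil_rpow_add_two_lt hβ₀ hn hL hC.le hlarge) hpow

end Exponents

theorem mainTheorem1_general (C β : ℝ) (hC : 0 < C) (hβ₀ : 0 ≤ β) (hβ₁ : β < 1) :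
    ∃ c : ℝ, 0 < c ∧
      ∀ n : ℕ, 2 ≤ n →
        ∀ σ : DyckWord, (σ.toList.length : ℝ) ≤ C * (n : ℝ) ^ β →
          ∀ (Q : Type*) [Fintype Q] (A : NFA (OCLetter n) Q),
            parikhImage A.accepts = universalOneCounterSet n →
              (n : ℝ) ^ (c * (σ.width : ℝ)) ≤ (Fintype.card Q : ℝ) := by
  obtain ⟨c, hc, hbound⟩ := exists_pos_rpow_mul_le hC hβ₀ hβ₁
  refine ⟨c, hc, fun n hn σ hσ Q _ A hP => ?_⟩
  exact hbound n σ.toList.length σ.width (Fintype.card Q) (by omega) hσ (width_le_length σ)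
    (le_card_states hP hn) fun b hb0 hb => pow_le_card_states hP hb hb0

theorem mainTheorem1 :
    ∀ C : ℝ, 0 < C → ∃ c : ℝ, 0 < c ∧
      ∀ n : ℕ, 2 ≤ n → Even n →
        ∀ σ : DyckWord, (σ.toList.length : ℝ) ≤ C * Real.sqrt n →
          ∀ (Q : Type*) [Fintype Q] (A : NFA (OCLetter n) Q),
            parikhImage A.accepts = universalOneCounterSet n →
              (n : ℝ) ^ (c * (σ.width : ℝ)) ≤ (Fintype.card Q : ℝ) := by
  intro C hC
  obtain ⟨c, hc, hbound⟩ := mainTheorem1_general C (1 / 2) hC (by norm_num) (by norm_num)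
  exact ⟨c, hc, fun n hn _ σ hσ => hbound n hn σ (by rwa [← Real.sqrt_eq_rpow])⟩
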